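/- Let $H$ be an $r\times n$ matrix over $\mathbb{F}_2$, let $C=\{c\in\mathbb{F}_2^n : Hc^{\mathsf T}=0\}$ be the binary linear code with parity-check matrix $H$, and let $T$ be its Tanner graph, i.e. the bipartite graph with bit nodes $x_1,\dots,x_n$ and check nodes $f_1,\dots,f_r$ in which $x_i$ and $f_j$ are adjacent if and only if $h_{ji}=1$. Let $\widehat T$ be a graph obtained from $T$ by duplicating some or all of the check nodes (each $f_j$ is replaced by one or more check nodes, all having the same neighbours as $f_j$), and assume that $\widehat T$ is bit-even, i.e. the degree $d_i$ in $\widehat T$ of every bit node $x_i$ is even. Let $\widehat C$ be the cycle code on $\widehat T$, i.e. the binary linear code, with coordinates indexed by the edges of $\widehat T$, spanned by the characteristic vectors of the simple cycles of $\widehat T$. Let $\zeta_{\widehat T}=\prod_{[\Gamma]}(1-g(\Gamma))^{-1}$ be the (Hashimoto) edge zeta function of $\widehat T$, a power series with integer coefficients in one indeterminate $u_e$ for each edge $e$ of $\widehat T$. Here a cycle is a sequence $\Gamma=(e_1,\dots,e_k)$ of edges that can be directed so that each edge ends where the next one begins and $e_k$ ends where $e_1$ begins; it is backtrackless if $e_s\neq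 e_{s+1}$ for $1\le s<k$, tailless if $e_1\ne e_k$, and primitive if it is not obtained by following another cycle $m\geq 2$ times; $g(\Gamma)=u_{e_1}\cdots u_{e_k}$; and the product runs over the backtrackless, tailless, primitive cycles up to cyclic rotation. An $M$-cover of $T$ ($M\ge 1$) is a graph $\widetilde T$ with a surjective graph homomorphism $\pi:\widetilde T\to T$ that maps the neighbourhood of every vertex $\tilde v$ bijectively onto the neighbourhood of $\pi(\tilde v)$ and all of whose fibres have $M$ elements; it is the Tanner graph of a code $\widetilde C\subseteq\mathbb{F}_2^{nM}$, whose coordinates $(i,k)$, $1\le k\le M$, correspond to the $M$ nodes above $x_i$. The unscaled pseudo-codewords of $C$ with respect to $T$ are the vectors $(p_1,\dots,p_n)$ for which there are an $M\geq 1$, an $M$-cover of $T$ and a codeword $a\in\widetilde C$ such that $p_i=\#\{k : a_{(i,k)}\neq 0\}$ for all $i$. Then: 1. If $T$ has no bit node of degree $0$, then $C$ is a punctured subcode of $\widehat C$: there are a linear subcode of $\widehat C$ and a choice of $n$ distinct coordinates, numbered $1,\dots,n$, such that deleting all other coordinates of the subcode yields exactly $C$. 2. The edges of $\widehat T$ can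 be labelled bijectively by the pairs $(i,j)$ with $1\le i\le n$ and $1\le j\le d_i$, the edges labelled $(i,1),\dots,(i,d_i)$ being those incident to $x_i$, in such a way that the unscaled pseudo-codewords of $C$ with respect to $T$ are precisely those vectors $(p_1,\dots,p_n)$ of nonnegative integers for which the monomial $\prod_{1\le i\le n,\;1\le j\le d_i}u_{(i,j)}^{p_i}$ has nonzero coefficient in the power series $\zeta_{\widehat T}$. -/

import Mathlib

namespace TannerCode

noncomputable section

/-! ### Binary linear codes and Tanner graphs -/

/-- The binary linear code with parity-check matrix `H` (rows `F` are checks, columns `X` are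
bits): all `c` with `H c = 0` over `𝔽₂`. -/
def code {F X : Type*} [Fintype X] (H : Matrix F X (ZMod 2)) : Submodule (ZMod 2) (X → ZMod 2) :=
  LinearMap.ker H.mulVecLin

/-- The Tanner graph of `H`: bit nodes `Sum.inl i`, check nodes `Sum.inr j`, with an edge between
`i` and `j` exactly when `H j i = 1`. -/
def tannerGraph {F X : Type*} (H : Matrix F X (ZMod 2)) : SimpleGraph (X ⊕ F) where
  Adj
    | Sum.inl i, Sum.inr j => H j i = 1
    | Sum.inr j, Sum.inl i => H j i = 1
    | _, _ => False
  symm := ⟨by rintro (i | j) (i' | j') h <;> exact h⟩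
  loopless := ⟨by rintro (i | j) h <;> exact h⟩

/-- The degree of the bit node `i` in the Tanner graph of `H`. -/
def bitDegree {F X : Type*} (H : Matrix F X (ZMod 2)) (i : X) : ℕ :=
  ((tannerGraph H).neighborSet (Sum.inl i)).ncard

/-- The Tanner graph of `H` is bit-even: every bit node has even degree. -/
def BitEven {F X : Type*} (H : Matrix F X (ZMod 2)) : Prop :=
  ∀ i, Even (bitDegree H i)

/-- The matrix obtained from `H` by replacing each row `j` by `copies j` copies of itself; on
Tanner graphs, check node `j` is replaced by `copies j` check nodes with the same neighbours. -/
def duplicateChecks {F X : Type*} (H : Matrix F X (ZMod 2)) (copies : F → ℕ) :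
    Matrix (Σ j, Fin (copies j)) X (ZMod 2) :=
  H.submatrix Sigma.fst id

/-! ### Covers and unscaled pseudo-codewords -/

/-- `π` is an unramified cover of the graph `G` by the graph `G'`: a surjective graph homomorphism
that maps the neighbourhood of every vertex bijectively onto that of its image. -/
structure IsCover {W V : Type*} (G' : SimpleGraph W) (G : SimpleGraph V) (π : W → V) : Prop where
  surjective : Function.Surjective π
  map_adj : ∀ ⦃v w⦄, G'.Adj v w → G.Adj (π v) (π w)
  bijOn : ∀ w, Set.BijOn π (G'.neighborSet w) (G.neighborSet (π w))

/-- `p` is an unscaled pseudo-codeword of the code of `H` with respect to its Tanner graph: for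
some `M ≥ 1` there are an `M`-cover of the Tanner graph, with the `M` nodes above each node `v`
labelled `(v, 1), …, (v, M)`, and a codeword `a` of the code defined by that cover, such that `p i`
is the number of nonzero `a (i, k)`. The cover is the Tanner graph of its own parity-check
matrix `H'`. -/
def IsUnscaledPseudocodeword {F X : Type*} [Fintype X]
    (H : Matrix F X (ZMod 2)) (p : X → ℕ) : Prop :=
  ∃ M : ℕ, 1 ≤ M ∧ ∃ H' : Matrix (F × Fin M) (X × Fin M) (ZMod 2),
    IsCover (tannerGraph H') (tannerGraph H) (Sum.map Prod.fst Prod.fst) ∧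
      ∃ a ∈ code H', ∀ i, p i = {k : Fin M | a (i, k) ≠ 0}.ncard

/-! ### Cycle codes and punctured subcodes -/

/-- The characteristic vector, in the coordinates given by the edges of `G`, of a walk in `G`. -/
def charVector {V : Type*} {G : SimpleGraph V} {v w : V} (γ : G.Walk v w) : G.edgeSet → ZMod 2 :=
  open Classical in fun e => if (e : Sym2 V) ∈ γ.edges then 1 else 0

/-- The cycle code on `G`: the span of the characteristic vectors of the simple cycles of `G`. -/
def cycleCode {V : Type*} (G : SimpleGraph V) : Submodule (ZMod 2) (G.edgeSet → ZMod 2) :=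
  Submodule.span (ZMod 2) {c | ∃ (v : V) (γ : G.Walk v v), γ.IsCycle ∧ charVector γ = c}

/-- `C` is a punctured subcode of `D`: there are a subcode `D'` of `D` and an injection `f` from
the coordinates of `C` into those of `D` (the positions that are kept) such that deleting all other
positions of `D'` gives exactly `C`. -/
def IsPuncturedSubcode {X Y : Type*} (C : Submodule (ZMod 2) (X → ZMod 2))
    (D : Submodule (ZMod 2) (Y → ZMod 2)) : Prop :=
  ∃ D' ≤ D, ∃ f : X ↪ Y, D'.map (LinearMap.funLeft (ZMod 2) (ZMod 2) f) = C

/-! ### The edge zeta function -/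

/-- The edge sequence `l` is a cycle in `G`: its edges can be directed so that each one ends where
the next one begins, and the last one ends where the first one begins. -/
def IsClosedPath {V : Type*} (G : SimpleGraph V) (l : List G.edgeSet) : Prop :=
  ∃ (v : V) (γ : G.Walk v v), γ.edges = l.map Subtype.val

/-- No two consecutive edges agree. -/
def IsBacktrackless {E : Type*} (l : List E) : Prop := l.IsChain (· ≠ ·)

/-- The first and the last edge differ (so `l` is not empty). -/
def IsTailless {E : Type*} (l : List E) : Prop := l.head? ≠ l.getLast?

/-- The cycle `l` is not obtained by following another cycle `r ≥ 2` times. -/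
def IsPrimitive {V : Type*} (G : SimpleGraph V) (l : List G.edgeSet) : Prop :=
  ¬ ∃ (θ : List G.edgeSet) (r : ℕ), 2 ≤ r ∧ IsClosedPath G θ ∧ l = (List.replicate r θ).flatten

/-- The equivalence classes (edge sequences up to rotation) of backtrackless, tailless, primitive
cycles in `G`. -/
def primeCycles {V : Type*} (G : SimpleGraph V) : Set (Cycle G.edgeSet) :=
  {c | ∃ l : List G.edgeSet, (l : Cycle G.edgeSet) = c ∧
    IsClosedPath G l ∧ IsBacktrackless l ∧ IsTailless l ∧ IsPrimitive G l}

/-- The monomial of a cycle: the product of the indeterminates `u_e` of its edges `e`. -/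
def cycleMonomial {E : Type*} (c : Cycle E) : MvPowerSeries E ℤ :=
  (c.toMultiset.map MvPowerSeries.X).prod

/-- The Euler factor `(1 - g)⁻¹` of a cycle with monomial `g`. -/
def eulerFactor {E : Type*} (c : Cycle E) : MvPowerSeries E ℤ :=
  MvPowerSeries.invOfUnit (1 - cycleMonomial c) 1

open scoped MvPowerSeries.WithPiTopology in
/-- The edge zeta function of `G`, a power series in one indeterminate for each edge: the product of
`(1 - g(Γ))⁻¹` over the classes of backtrackless, tailless, primitive cycles `Γ`, which converges
coefficientwise. -/
def edgeZeta {V : Type*} (G : SimpleGraph V) : MvPowerSeries G.edgeSet ℤ :=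
  ∏' c : primeCycles G, eulerFactor (c : Cycle G.edgeSet)

/-! The Euler factors are inverses, and the product converges for finite graphs. -/

theorem ne_nil_of_mem_primeCycles {V : Type*} {G : SimpleGraph V} {c : Cycle G.edgeSet}
    (hc : c ∈ primeCycles G) : c ≠ Cycle.nil := by
  obtain ⟨l, rfl, -, -, ht, -⟩ := hc
  rintro h
  rw [Cycle.coe_eq_nil] at h
  subst h
  exact ht rfl

theorem coeff_cycleMonomial_mul {E : Type*} (c : Cycle E) (f : MvPowerSeries E ℤ) (d : E →₀ ℕ)
    (h : d.degree < c.length) : MvPowerSeries.coeff d (cycleMonomial c * f) = 0 := by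
  have key : ∀ s : Multiset E,
      (s.card : ℕ∞) ≤ ((s.map MvPowerSeries.X).prod : MvPowerSeries E ℤ).order := by
    intro s
    induction s using Multiset.induction_on with
    | empty => simp
    | cons a s ih =>
      rw [Multiset.map_cons, Multiset.prod_cons, Multiset.card_cons]
      refine le_trans ?_ MvPowerSeries.le_order_mul
      have hX : (1 : ℕ∞) ≤ (MvPowerSeries.X a : MvPowerSeries E ℤ).order := by
        rw [Order.one_le_iff_pos, pos_iff_ne_zero,
          MvPowerSeries.order_ne_zero_iff_constCoeff_eq_zero]
        simp
      push_cast
      rw [add_comm]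
      exact add_le_add hX ih
  apply MvPowerSeries.coeff_of_lt_order
  refine lt_of_lt_of_le ?_ (le_trans (le_trans (key c.toMultiset) le_self_add)
    MvPowerSeries.le_order_mul)
  rw [Cycle.card_toMultiset]
  exact_mod_cast h

theorem one_sub_cycleMonomial_mul_eulerFactor {E : Type*} {c : Cycle E} (hc : c ≠ Cycle.nil) :
    (1 - cycleMonomial c) * eulerFactor c = 1 := by
  apply MvPowerSeries.mul_invOfUnit
  have h0 : 0 < c.length := by
    rw [Nat.pos_iff_ne_zero, ← Cycle.card_toMultiset, Ne, Multiset.card_eq_zero,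
      Cycle.toMultiset_eq_nil]
    exact hc
  have := coeff_cycleMonomial_mul c 1 0 (by simpa using h0)
  rw [mul_one, MvPowerSeries.coeff_zero_eq_constantCoeff_apply] at this
  simp [this]

open scoped MvPowerSeries.WithPiTopology in
theorem multipliable_eulerFactor {V : Type*} [Finite V] (G : SimpleGraph V) :
    Multipliable fun c : primeCycles G => eulerFactor (c : Cycle G.edgeSet) := by
  classical
  have hrw : (fun c : primeCycles G => eulerFactor (c : Cycle G.edgeSet)) =
      fun c : primeCycles G => 1 + cycleMonomial (c : Cycle G.edgeSet) * eulerFactor (c : Cycle G.edgeSet) := by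
    funext c
    have := one_sub_cycleMonomial_mul_eulerFactor (ne_nil_of_mem_primeCycles c.2)
    rw [sub_mul, one_mul, sub_eq_iff_eq_add] at this
    exact this
  rw [hrw]
  apply multipliable_one_add_of_summable_prod
  refine MvPowerSeries.WithPiTopology.summable_iff_summable_coeff.mpr fun d =>
    summable_of_hasFiniteSupport ?_
  have hfin : {c : primeCycles G | (c : Cycle G.edgeSet).length ≤ d.degree}.Finite := by
    apply Set.Finite.of_finite_image (f := Subtype.val) _ Subtype.val_injective.injOn
    refine (Set.Finite.image (fun l : List G.edgeSet => (l : Cycle G.edgeSet))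
      (List.finite_length_le G.edgeSet d.degree)).subset ?_
    rintro _ ⟨c, hc, rfl⟩
    obtain ⟨l, hl, -⟩ := c.2
    refine ⟨l, ?_, hl⟩
    have hc' : (c : Cycle G.edgeSet).length ≤ d.degree := hc
    rw [← hl] at hc'
    exact hc'
  refine (hfin.toFinset.powerset.finite_toSet).subset ?_
  intro s hs
  rw [Finset.mem_coe, Finset.mem_powerset]
  intro c hcs
  rw [Set.Finite.mem_toFinset]
  by_contra hlt
  refine hs ?_
  simp only
  rw [← Finset.mul_prod_erase s _ hcs, mul_assoc]
  exact coeff_cycleMonomial_mul _ _ _ (not_le.mp hlt)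

end

end TannerCode

open TannerCode

namespace TannerCode

/-! Pseudo-codewords and zeta monomials are both compared with the vectors `p` of
`IsEvenConeVector`: at each check the incident values have even sum, and none exceeds half of it.
This condition does not change when checks are duplicated.

For covers, a lifted check sees one node above each neighbour and an even number of nonzero ones;
summing over the lifts of a check gives the condition. Conversely, an even multiset in which no
colour fills more than half splits into bichromatic pairs (`exists_bichromatic_pairing`). Handing
each pair to its own lift of the check prescribes the edges of a cover.

For the zeta function, all coefficients are nonnegative, so nothing cancels and the exponents that
occur are exactly the sums of exponents of prime cycles (`coeff_edgeZeta_ne_zero_iff`). A prime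
cycle passes a vertex through pairs of distinct edges, which gives the cone condition. Conversely,
take `p i` copies of each edge at bit `i` and match them bichromatically at both ends: at checks by
the cone condition, at bits because the degree is even and all multiplicities agree. Following the
two matchings alternately decomposes the copies into backtrackless tailless closed walks, which are
powers of prime cycles.

For the punctured code, repeat each bit of a codeword on all its edges. Even bit degrees and the
check equations make every vertex sum vanish, so the result lies in the cycle code
(`mem_cycleCode_of_sum_eq_zero`). -/

/-! ### Bichromatic pairings -/

open Finset in
/-- A coloured set of `2 * h` elements in which no colour occurs more than `h` times can be split
into `h` pairs of differently coloured elements. -/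
theorem exists_bichromatic_pairing {A E : Type*} [DecidableEq A] [LinearOrder E] (s : Finset A)
    (c : A → E) (h : ℕ) (hs : #s = 2 * h) (hc : ∀ e, #{a ∈ s | c a = e} ≤ h) :
    ∃ q : A → ℕ, (∀ a ∈ s, q a < h) ∧ (∀ a ∈ s, ∀ b ∈ s, q a = q b → c a = c b → a = b) ∧
      ∀ k < h, #{a ∈ s | q a = k} = 2 := by
  obtain ⟨e0⟩ : Nonempty (Fin (2 * h) ≃ s) := ⟨(s.equivFinOfCardEq hs).symm⟩
  let f : Fin (2 * h) → E := fun k => c (e0 k)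
  -- Sort by colour and pair position `k` with `k + h`. If both had the same colour, so would all `h
  -- + 1` positions between them, one more than allowed.
  let e : Fin (2 * h) ≃ s := (Tuple.sort f).trans e0
  have hmono : Monotone fun k => c (e k) := Tuple.monotone_sort f
  have hsplit : ∀ k l : Fin (2 * h), k < l → (k : ℕ) % h = l % h → (l : ℕ) = k + h := by
    intro k l hkl hm
    have hk := k.2
    have hl := l.2
    have hkl' : (k : ℕ) < l := hkl
    rcases lt_or_ge (l : ℕ) h with h1 | h1
    · rw [Nat.mod_eq_of_lt h1, Nat.mod_eq_of_lt (by omega)] at hm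
      omega
    · have h2 : (l : ℕ) % h = l - h := by
        rw [Nat.mod_eq_sub_mod h1, Nat.mod_eq_of_lt (by omega)]
      rcases lt_or_ge (k : ℕ) h with h3 | h3
      · rw [h2, Nat.mod_eq_of_lt h3] at hm
        omega
      · rw [h2, Nat.mod_eq_sub_mod h3, Nat.mod_eq_of_lt (by omega)] at hm
        omega
  have hne : ∀ k l : Fin (2 * h), k < l → (k : ℕ) % h = l % h → c (e k) ≠ c (e l) := by
    intro k l hkl hm heq
    have hl := hsplit k l hkl hm
    have hsub : (Finset.Icc k l).map (e.toEmbedding.trans (Function.Embedding.subtype _)) ⊆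
        {a ∈ s | c a = c (e k)} := by
      intro a ha
      rw [Finset.mem_map] at ha
      obtain ⟨m, hm, rfl⟩ := ha
      rw [Finset.mem_Icc] at hm
      rw [Finset.mem_filter]
      refine ⟨(e m).2, le_antisymm ?_ (hmono hm.1)⟩
      rw [heq]
      exact hmono hm.2
    have := (Finset.card_le_card hsub).trans (hc _)
    rw [Finset.card_map, Fin.card_Icc] at this
    omega
  refine ⟨fun a => if ha : a ∈ s then (e.symm ⟨a, ha⟩ : ℕ) % h else 0, ?_, ?_, ?_⟩
  · intro a ha
    simp only [ha, dif_pos]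
    have := (e.symm ⟨a, ha⟩).2
    exact Nat.mod_lt _ (by omega)
  · intro a ha b hb hq hab
    simp only [ha, hb, dif_pos] at hq
    rcases lt_trichotomy (e.symm ⟨a, ha⟩) (e.symm ⟨b, hb⟩) with h1 | h1 | h1
    · exact absurd (by simpa using hab) (hne _ _ h1 hq)
    · simpa using h1
    · exact absurd (by simpa using hab.symm) (hne _ _ h1 hq.symm)
  · intro k hk
    rw [Finset.card_eq_two]
    refine ⟨e ⟨k, by omega⟩, e ⟨k + h, by omega⟩, ?_, ?_⟩
    · intro h1
      have := e.injective (Subtype.ext h1)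
      rw [Fin.mk.injEq] at this
      omega
    · ext a
      simp only [Finset.mem_filter, Finset.mem_insert, Finset.mem_singleton]
      constructor
      · rintro ⟨ha, hq⟩
        simp only [ha, dif_pos] at hq
        obtain ⟨m, hm⟩ := e.surjective ⟨a, ha⟩
        rw [← hm, Equiv.symm_apply_apply] at hq
        have hm2 := m.2
        have : (m : ℕ) = k ∨ (m : ℕ) = k + h := by
          rcases lt_or_ge (m : ℕ) h with h1 | h1
          · rw [Nat.mod_eq_of_lt h1] at hq
            omega
          · rw [Nat.mod_eq_sub_mod h1, Nat.mod_eq_of_lt (by omega)] at hq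
            omega
        have ha' : a = e m := by rw [hm]
        rcases this with h1 | h1
        · left; rw [ha']; congr 2; exact Fin.ext h1
        · right; rw [ha']; congr 2; exact Fin.ext h1
      · rintro (rfl | rfl)
        · simp [Nat.mod_eq_of_lt hk]
        · simp [Nat.mod_eq_of_lt hk]

/-- Elements of a finite type, each located at a node and coloured, can be matched at every node
with differently coloured elements, if every node has an even number of elements no more than half
of which share a colour. -/
theorem exists_bichromatic_involution {A V E : Type*} [Fintype A] [DecidableEq A] [DecidableEq V]
    [Finite E] [DecidableEq E] (node : A → V) (c : A → E)
    (heven : ∀ v, Even (Finset.card {a | node a = v}))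
    (hc : ∀ v e, 2 * Finset.card {a | node a = v ∧ c a = e} ≤ Finset.card {a | node a = v}) :
    ∃ α : A → A, ∀ a, α (α a) = a ∧ node (α a) = node a ∧ c (α a) ≠ c a := by
  -- Numbering the colours supplies the linear order needed for sorting.
  obtain ⟨N, ⟨ι⟩⟩ := Finite.exists_equiv_fin E
  have hq : ∀ v, ∃ q : A → ℕ, (∀ a b, node a = v → node b = v → q a = q b → c a = c b → a = b) ∧
      ∀ a, node a = v → Finset.card {b | node b = v ∧ q b = q a} = 2 := by
    intro v
    obtain ⟨h, hh⟩ := heven v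
    obtain ⟨q, hq1, hq2, hq3⟩ := exists_bichromatic_pairing ({a | node a = v} : Finset A)
      (fun a => ι (c a)) h (by omega) (by
        intro e
        have := hc v (ι.symm e)
        rw [Finset.filter_filter]
        simp only [← Equiv.eq_symm_apply]
        omega)
    refine ⟨q, ?_, ?_⟩
    · intro a b ha hb hab hcab
      exact hq2 a (by simpa using ha) b (by simpa using hb) hab (by rw [hcab])
    · intro a ha
      have := hq3 (q a) (hq1 a (by simpa using ha))
      rwa [Finset.filter_filter] at this
  choose q hq1 hq2 using hq
  have hex : ∀ a, ∃ b, b ≠ a ∧ node b = node a ∧ q (node a) b = q (node a) a ∧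
      ∀ b', b' ≠ a → node b' = node a → q (node a) b' = q (node a) a → b' = b := by
    intro a
    obtain ⟨x, y, hxy, hs⟩ := Finset.card_eq_two.mp (hq2 (node a) a rfl)
    have hmem : ∀ b, (node b = node a ∧ q (node a) b = q (node a) a) ↔ b = x ∨ b = y := by
      intro b
      have := Finset.ext_iff.mp hs b
      simpa using this
    rcases (hmem a).mp ⟨rfl, rfl⟩ with h | h
    · have hy := (hmem y).mpr (Or.inr rfl)
      exact ⟨y, by rw [h]; exact hxy.symm, hy.1, hy.2, fun b' h1 h2 h3 =>
        ((hmem b').mp ⟨h2, h3⟩).resolve_left (h ▸ h1)⟩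
    · have hx := (hmem x).mpr (Or.inl rfl)
      exact ⟨x, by rw [h]; exact hxy, hx.1, hx.2, fun b' h1 h2 h3 =>
        ((hmem b').mp ⟨h2, h3⟩).resolve_right (h ▸ h1)⟩
  choose α h1 h2 h3 h4 using hex
  refine ⟨α, fun a => ⟨?_, h2 a, fun hca => h1 a (hq1 (node a) _ _ (h2 a) rfl (h3 a) hca)⟩⟩
  exact (h4 (α a) a (h1 a).symm (h2 a).symm (by rw [h2 a, h3 a])).symm

/-! ### The support of the zeta function -/

open MvPowerSeries

/-- The exponent vector of the monomial of a cycle. -/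
noncomputable def cycleExponent {E : Type*} (c : Cycle E) : E →₀ ℕ :=
  open Classical in Multiset.toFinsupp c.toMultiset

theorem cycleMonomial_eq_monomial {E : Type*} (c : Cycle E) :
    cycleMonomial c = monomial (cycleExponent c) (1 : ℤ) := by
  classical
  have key : ∀ s : Multiset E, ((s.map MvPowerSeries.X).prod : MvPowerSeries E ℤ) =
      monomial (Multiset.toFinsupp s) (1 : ℤ) := by
    intro s
    induction s using Multiset.induction_on with
    | empty => simp
    | cons a s ih =>
      rw [Multiset.map_cons, Multiset.prod_cons, ih, MvPowerSeries.X, monomial_mul_monomial,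
        ← Multiset.singleton_add, map_add, Multiset.toFinsupp_singleton, one_mul]
  rw [cycleMonomial, key, cycleExponent]

theorem cycleExponent_ne_zero {E : Type*} {c : Cycle E} (hc : c ≠ Cycle.nil) :
    cycleExponent c ≠ 0 := by
  classical
  rwa [cycleExponent, Ne, EmbeddingLike.map_eq_zero_iff, Cycle.toMultiset_eq_nil]

/-- All coefficients are nonnegative, and the nonzero ones are those at `S`. -/
def HasNonnegSupport {E : Type*} (f : MvPowerSeries E ℤ) (S : Set (E →₀ ℕ)) : Prop :=
  ∀ d, 0 ≤ coeff d f ∧ (0 < coeff d f ↔ d ∈ S)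

-- Nonnegativity rules out cancellation in the convolution, so supports simply add.
open scoped Pointwise in
theorem HasNonnegSupport.mul {E : Type*} {f g : MvPowerSeries E ℤ} {S T : Set (E →₀ ℕ)}
    (hf : HasNonnegSupport f S) (hg : HasNonnegSupport g T) : HasNonnegSupport (f * g) (S + T) := by
  classical
  intro d
  have h0 : ∀ x ∈ Finset.HasAntidiagonal.antidiagonal d, 0 ≤ coeff x.1 f * coeff x.2 g := fun x _ =>
    mul_nonneg (hf _).1 (hg _).1
  rw [coeff_mul]
  refine ⟨Finset.sum_nonneg h0, ?_⟩
  rw [Finset.sum_pos_iff_of_nonneg h0, Set.mem_add]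
  constructor
  · rintro ⟨x, hx, hpos⟩
    have h1 : 0 < coeff x.1 f := lt_of_le_of_ne (hf _).1 fun h => by simp [← h] at hpos
    have h2 : 0 < coeff x.2 g := lt_of_le_of_ne (hg _).1 fun h => by simp [← h] at hpos
    exact ⟨x.1, (hf _).2.mp h1, x.2, (hg _).2.mp h2, Finset.HasAntidiagonal.mem_antidiagonal.mp hx⟩
  · rintro ⟨a, ha, b, hb, rfl⟩
    exact ⟨(a, b), by simp, mul_pos ((hf a).2.mpr ha) ((hg b).2.mpr hb)⟩

theorem hasNonnegSupport_one {E : Type*} : HasNonnegSupport (1 : MvPowerSeries E ℤ) {0} := by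
  classical
  intro d
  rw [coeff_one]
  split_ifs with h <;> simp [h]

/-- The recursion `f = 1 + g * f` determines each coefficient from one of strictly smaller degree,
because the monomial `g` is not constant. -/
theorem hasNonnegSupport_eulerFactor {E : Type*} {c : Cycle E} (hc : c ≠ Cycle.nil) :
    HasNonnegSupport (eulerFactor c) {d | ∃ k : ℕ, d = k • cycleExponent c} := by
  classical
  have h1 : eulerFactor c = 1 + cycleMonomial c * eulerFactor c := by
    have := one_sub_cycleMonomial_mul_eulerFactor hc
    rw [sub_mul, one_mul, sub_eq_iff_eq_add] at this
    exact this
  have hμ := cycleExponent_ne_zero hc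
  intro d
  induction hn : d.degree using Nat.strong_induction_on generalizing d with
  | _ n ih =>
    subst hn
    rw [h1, map_add, coeff_one, cycleMonomial_eq_monomial, coeff_monomial_mul]
    by_cases hd : d = 0
    · subst hd
      have : ¬ cycleExponent c ≤ 0 := fun h => hμ (le_antisymm h zero_le)
      simp only [this, if_true, if_false]
      refine ⟨by norm_num, fun _ => ⟨0, by simp⟩, fun _ => by norm_num⟩
    · rw [if_neg hd, zero_add]
      split_ifs with hle
      · rw [one_mul]
        obtain ⟨d', rfl⟩ := exists_add_of_le hle
        rw [add_tsub_cancel_left]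
        have hpos : 0 < (cycleExponent c).degree := by
          rw [Nat.pos_iff_ne_zero, Ne, Finsupp.degree_eq_zero_iff]
          exact hμ
        obtain ⟨h2, h3⟩ := ih d'.degree (by rw [map_add]; omega) d' rfl
        refine ⟨h2, h3.trans ⟨?_, ?_⟩⟩
        · rintro ⟨k, rfl⟩
          exact ⟨k + 1, by rw [add_smul, one_smul, add_comm]⟩
        · rintro ⟨k, hk⟩
          cases k with
          | zero => simp [hd] at hk; 
          | succ k =>
            rw [add_smul, one_smul, add_comm] at hk
            exact ⟨k, add_right_cancel hk⟩
      · refine ⟨le_refl _, fun h => absurd h (lt_irrefl _), ?_⟩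
        rintro ⟨k, rfl⟩
        cases k with
        | zero => simp at hd
        | succ k =>
          refine absurd ?_ hle
          rw [add_smul, one_smul]
          exact le_add_self

theorem hasNonnegSupport_prod_eulerFactor {E ι : Type*} (γ : ι → Cycle E)
    (hγ : ∀ i, γ i ≠ Cycle.nil) (s : Finset ι) :
    HasNonnegSupport (∏ i ∈ s, eulerFactor (γ i))
      {d | ∃ k : ι → ℕ, d = ∑ i ∈ s, k i • cycleExponent (γ i)} := by
  classical
  induction s using Finset.induction_on with
  | empty => simpa using hasNonnegSupport_one
  | insert a s ha ih =>
    rw [Finset.prod_insert ha]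
    convert (hasNonnegSupport_eulerFactor (hγ a)).mul ih using 1
    ext d
    simp only [Set.mem_ofPred_eq, Set.mem_add]
    constructor
    · rintro ⟨k, rfl⟩
      exact ⟨_, ⟨k a, rfl⟩, _, ⟨k, rfl⟩, (Finset.sum_insert ha).symm⟩
    · rintro ⟨_, ⟨l, rfl⟩, _, ⟨k, rfl⟩, rfl⟩
      refine ⟨Function.update k a l, ?_⟩
      rw [Finset.sum_insert ha, Function.update_self]
      congr 1
      refine Finset.sum_congr rfl fun i hi => ?_
      rw [Function.update_of_ne (ne_of_mem_of_not_mem hi ha)]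

open scoped MvPowerSeries.WithPiTopology in
/-- The monomials of the edge zeta function are the products of monomials of prime cycles. -/
theorem coeff_edgeZeta_ne_zero_iff {V : Type*} [Finite V] (G : SimpleGraph V)
    (d : G.edgeSet →₀ ℕ) :
    coeff d (edgeZeta G) ≠ 0 ↔
      ∃ m : Multiset (primeCycles G),
        d = (m.map fun c : primeCycles G => cycleExponent (c : Cycle G.edgeSet)).sum := by
  classical
  have hprod := (multipliable_eulerFactor G).hasProd
  have htend := ((WithPiTopology.continuous_coeff (R := ℤ) d).tendsto _).comp hprod
  -- Taking a coefficient is continuous and `ℤ` is discrete, so the coefficient is already that of a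
  -- sufficiently large finite product.
  have hev : ∀ᶠ s : Finset (primeCycles G) in Filter.atTop,
      coeff d (∏ c ∈ s, eulerFactor (c : Cycle G.edgeSet)) = coeff d (edgeZeta G) := by
    have := htend.eventually_mem (show {coeff d (edgeZeta G)} ∈ nhds (coeff d (edgeZeta G)) by simp)
    simpa [edgeZeta] using this
  obtain ⟨s, hs⟩ := Filter.eventually_atTop.mp hev
  have hsupp := fun t => hasNonnegSupport_prod_eulerFactor
    (fun c : primeCycles G => (c : Cycle G.edgeSet)) (fun c => ne_nil_of_mem_primeCycles c.2) t d
  constructor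
  · intro h
    rw [← hs s le_rfl] at h
    obtain ⟨k, hk⟩ := (hsupp s).2.mp (lt_of_le_of_ne (hsupp s).1 h.symm)
    refine ⟨∑ c ∈ s, k c • {c}, ?_⟩
    rw [hk, ← Multiset.coe_mapAddMonoidHom, ← Multiset.coe_sumAddMonoidHom, map_sum, map_sum]
    simp [Multiset.map_nsmul, Multiset.sum_nsmul]
  · rintro ⟨m, rfl⟩
    -- Enlarging `s` keeps the coefficient and makes every cycle of `m` a factor.
    rw [← hs (s ∪ m.toFinset) Finset.subset_union_left]
    refine ((hsupp _).2.mpr ⟨fun c => m.count c, ?_⟩).ne'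
    rw [Finset.sum_multiset_map_count]
    refine Finset.sum_subset Finset.subset_union_right fun c _ hc => ?_
    rw [Multiset.count_eq_zero_of_notMem (by simpa using hc), zero_smul]

/-! ### Vertices on closed walks -/

/-- Every interior visit to `v` uses two edge ends, while the start and the end of the walk use one
each. -/
theorem even_countP_edges_iff {V : Type*} [DecidableEq V] {G : SimpleGraph V} {u w : V}
    (γ : G.Walk u w) (v : V) :
    Even (γ.edges.countP fun e => v ∈ e) ↔ (u = w ∨ (v ≠ u ∧ v ≠ w)) := by
  induction γ with
  | nil => simp
  | @cons a b c h γ ih =>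
    rw [SimpleGraph.Walk.edges_cons, List.countP_cons]
    have hab := h.ne
    by_cases hv : v ∈ s(a, b)
    · simp only [hv, decide_true, if_true, Nat.even_add_one, ih]
      rw [Sym2.mem_iff] at hv
      grind
    · simp only [hv, decide_false, Bool.false_eq_true, if_false, add_zero, ih]
      rw [Sym2.mem_iff] at hv
      grind

/-- The weight `±1` of an edge end, according to whether it lies on the edge `e`. -/
def endWeight {E : Type*} [DecidableEq E] (e x : E) : ℤ := if x = e then -1 else 1

theorem endWeight_add_nonneg {E : Type*} [DecidableEq E] {e x y : E} (h : x ≠ y) :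
    0 ≤ endWeight e x + endWeight e y := by
  unfold endWeight
  grind

/-- At an interior visit to `v` the two consecutive edges differ, so their weights add up to at
least `0`. Dropping these visits leaves only the first and last edge ends. -/
theorem endWeight_le_sum_of_isBacktrackless {V : Type*} [DecidableEq V] {G : SimpleGraph V}
    (e : Sym2 V) (v : V) {u w : V} (γ : G.Walk u w) (hne : γ.edges ≠ [])
    (hb : IsBacktrackless γ.edges) :
    (if u = v then endWeight e (γ.edges.head hne) else 0) +
        (if w = v then endWeight e (γ.edges.getLast hne) else 0) ≤
      (γ.edges.map fun x => if v ∈ x then endWeight e x else 0).sum := by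
  induction γ with
  | nil => simp at hne
  | @cons a b c h γ ih =>
    have hab := h.ne
    cases γ with
    | nil =>
      simp only [SimpleGraph.Walk.edges_cons, SimpleGraph.Walk.edges_nil, List.head_cons,
        List.getLast_singleton, List.map_cons, List.map_nil, List.sum_cons, List.sum_nil,
        Sym2.mem_iff]
      grind
    | @cons _ b' _ h' γ =>
      have hb' : IsBacktrackless (s(a, b) :: s(b, b') :: γ.edges) := hb
      rw [IsBacktrackless, List.isChain_cons_cons] at hb'
      have h1 := ih (by simp) hb'.2
      have h2 := endWeight_add_nonneg (e := e) hb'.1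
      simp only [SimpleGraph.Walk.edges_cons, List.head_cons, List.map_cons, List.sum_cons,
        List.getLast_cons_cons, Sym2.mem_iff] at h1 ⊢
      grind

theorem sum_endWeight {V : Type*} [DecidableEq V] {e : Sym2 V} {v : V} (hv : v ∈ e)
    (l : List (Sym2 V)) :
    (l.map fun x => if v ∈ x then endWeight e x else 0).sum =
      (l.countP fun x => v ∈ x : ℕ) - 2 * (l.count e : ℕ) := by
  induction l with
  | nil => simp
  | cons x l ih =>
    rw [List.map_cons, List.sum_cons, ih, List.countP_cons, List.count_cons]
    unfold endWeight
    by_cases hx : x = e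
    · subst hx; simp [hv]; ring
    · by_cases hvx : v ∈ x
      · simp [hx, hvx]; ring
      · simp [hx, hvx]

theorem even_countP_of_isClosedPath {V : Type*} [DecidableEq V] {G : SimpleGraph V}
    {l : List G.edgeSet} (hl : IsClosedPath G l) (v : V) :
    Even (l.countP fun x : G.edgeSet => v ∈ (x : Sym2 V)) := by
  obtain ⟨u, γ, hγ⟩ := hl
  have := (even_countP_edges_iff γ v).mpr (Or.inl rfl)
  rwa [hγ, List.countP_map] at this

theorem two_mul_count_le_countP {V : Type*} [DecidableEq V] {G : SimpleGraph V}
    {l : List G.edgeSet} (hl : IsClosedPath G l) (hb : IsBacktrackless l) (ht : IsTailless l)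
    (v : V) (e : G.edgeSet) (hv : v ∈ (e : Sym2 V)) :
    2 * l.count e ≤ l.countP fun x : G.edgeSet => v ∈ (x : Sym2 V) := by
  obtain ⟨u, γ, hγ⟩ := hl
  have hl0 : l ≠ [] := by rintro rfl; exact ht rfl
  have hne : γ.edges ≠ [] := fun h => hl0 (List.map_eq_nil_iff.mp (hγ ▸ h))
  have hbγ : IsBacktrackless γ.edges := by
    rw [hγ, IsBacktrackless, List.isChain_map]
    exact hb.imp fun a b hab h => hab (Subtype.ext h)
  have h1 := endWeight_le_sum_of_isBacktrackless e v γ hne hbγ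
  have hcount : γ.edges.count (e : Sym2 V) = l.count e := by
    rw [hγ, List.count_map_of_injective _ _ Subtype.val_injective]
  have hcountP : (γ.edges.countP fun x => v ∈ x) =
      l.countP fun x : G.edgeSet => v ∈ (x : Sym2 V) := by
    rw [hγ, List.countP_map]
    rfl
  rw [sum_endWeight hv, hcount, hcountP] at h1
  -- Taillessness treats the base point like an interior visit: the two boundary weights also have a
  -- nonnegative sum.
  have h2 : γ.edges.head hne ≠ γ.edges.getLast hne := by
    intro h
    simp only [hγ, List.head_map, List.getLast_map] at h
    refine ht ?_
    rw [List.head?_eq_some_head hl0, List.getLast?_eq_some_getLast hl0, Subtype.ext h]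
  have h3 := endWeight_add_nonneg (e := (e : Sym2 V)) h2
  split_ifs at h1 <;> omega

/-! ### Decomposition into prime cycles -/

/-- Every backtrackless, tailless cycle is a power of a primitive one. -/
theorem exists_primeCycle_nsmul {V : Type*} {G : SimpleGraph V} (l : List G.edgeSet)
    (hl : IsClosedPath G l) (hb : IsBacktrackless l) (ht : IsTailless l) :
    ∃ (c : primeCycles G) (k : ℕ), (l : Multiset G.edgeSet) =
      k • (c : Cycle G.edgeSet).toMultiset := by
  induction hn : l.length using Nat.strong_induction_on generalizing l with
  | _ n ih =>
    by_cases hp : IsPrimitive G l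
    · exact ⟨⟨l, l, rfl, hl, hb, ht, hp⟩, 1, by simp⟩
    · rw [IsPrimitive, not_not] at hp
      obtain ⟨θ, r, hr, hθ, rfl⟩ := hp
      obtain ⟨r, rfl⟩ := Nat.exists_eq_add_of_le' hr
      have hθ0 : θ ≠ [] := by
        rintro rfl
        exact ht (by simp)
      have hpos := List.length_pos_of_ne_nil hθ0
      have h1 : (List.replicate (r + 2) θ).flatten = θ ++ (List.replicate (r + 1) θ).flatten := by
        rw [List.replicate_succ, List.flatten_cons]
      have h2 : (List.replicate (r + 2) θ).flatten = (List.replicate (r + 1) θ).flatten ++ θ := by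
        rw [List.replicate_succ', List.flatten_append]
        simp
      -- The root `θ` is shorter since `r ≥ 2`. It is backtrackless as a prefix of the cycle, and
      -- tailless because it has the same first and last edge.
      obtain ⟨c, k, hck⟩ := ih θ.length (by
        rw [← hn, List.length_flatten, List.map_replicate, List.sum_replicate, smul_eq_mul]
        nlinarith) θ hθ
        (by
          rw [h1] at hb
          exact (List.isChain_append.mp hb).1)
        (by
          intro h
          apply ht
          nth_rw 1 [h1]
          rw [h2, List.head?_append_of_ne_nil _ hθ0, List.getLast?_append_of_ne_nil _ hθ0, h]) rfl
      refine ⟨c, (r + 2) * k, ?_⟩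
      rw [mul_smul, ← hck]
      generalize r + 2 = r
      induction r with
      | zero => simp
      | succ r ih' =>
        rw [List.replicate_succ, List.flatten_cons, ← Multiset.coe_add, ih', add_smul, one_smul,
          add_comm]

/-- The list is the orbit of `a` under the two involutions, in the order `a, α a, β (α a), …`.
Consecutive entries share alternately their `u`-end and their `w`-end, and matched copies lie on
different edges, so the walk neither backtracks nor has a tail. -/
theorem exists_isClosedPath_of_involutions {V A : Type*} {G : SimpleGraph V} [Finite A]
    (u w : G.edgeSet → V) (huw : ∀ x : G.edgeSet, (x : Sym2 V) = s(u x, w x)) (ε : A → G.edgeSet)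
    (α β : A → A) (hα : ∀ a, α (α a) = a ∧ u (ε (α a)) = u (ε a) ∧ ε (α a) ≠ ε a)
    (hβ : ∀ a, β (β a) = a ∧ w (ε (β a)) = w (ε a) ∧ ε (β a) ≠ ε a) (a : A) :
    ∃ L : List A, L.Nodup ∧ a ∈ L ∧ (∀ b ∈ L, α b ∈ L ∧ β b ∈ L) ∧
      (∀ S : Set A, a ∈ S → (∀ b ∈ S, α b ∈ S ∧ β b ∈ S) → ∀ b ∈ L, b ∈ S) ∧
      IsClosedPath G (L.map ε) ∧ IsBacktrackless (L.map ε) ∧ IsTailless (L.map ε) := by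
  have hαfix : ∀ x, α x ≠ x := fun x h => (hα x).2.2 (by rw [h])
  have hβfix : ∀ x, β x ≠ x := fun x h => (hβ x).2.2 (by rw [h])
  have hαinj : Function.Injective α := fun x y h => by rw [← (hα x).1, h, (hα y).1]
  have hβinj : Function.Injective β := fun x y h => by rw [← (hβ x).1, h, (hβ y).1]
  obtain ⟨σ, hσ⟩ : ∃ σ : A → A, σ = fun x => β (α x) := ⟨_, rfl⟩
  have hσa : ∀ x, σ x = β (α x) := fun x => by rw [hσ]
  have hσinj : Function.Injective σ := hσ ▸ hβinj.comp hαinj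
  -- An equality for `n + 2` at `x` gives one for `n` at `σ x`; the descent ends at a fixed point of
  -- `α` or of `β`.
  have hdisj : ∀ n x, α x ≠ σ^[n] x := by
    intro n
    induction n using Nat.twoStepInduction with
    | zero => exact hαfix
    | one =>
      intro x h
      rw [Function.iterate_one, hσa] at h
      exact hβfix _ h.symm
    | more n ih _ =>
      intro x h
      rw [Function.iterate_succ_apply', Function.iterate_succ_apply, hσa (σ^[n] _)] at h
      have h1 : σ x = α (σ^[n] (σ x)) :=
        (hσa x).trans (by rw [h, (hβ _).1])
      have h2 := congrArg α h1
      rw [(hα _).1] at h2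
      exact ih (σ x) h2
  have hper : a ∈ Function.periodicPts σ := hσinj.mem_periodicPts a
  obtain ⟨k, hk⟩ : ∃ k, k = Function.minimalPeriod σ a := ⟨_, rfl⟩
  have hk0 : 0 < k := hk ▸ Function.minimalPeriod_pos_of_mem_periodicPts hper
  have hka : σ^[k] a = a := hk ▸ Function.iterate_minimalPeriod
  have hmodk : ∀ n, σ^[n % k] a = σ^[n] a := by
    intro n
    rw [hk, Function.iterate_mod_minimalPeriod_eq]
  have hinjk : ∀ m n, m < k → n < k → σ^[m] a = σ^[n] a → m = n := by
    intro m n hm hn h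
    exact Function.iterate_injOn_Iio_minimalPeriod (by rwa [← hk]) (by rwa [← hk]) h
  -- Round `i` crosses `σ^[i] a` from its `w`-end to its `u`-end and returns along its `α`-partner
  -- to the `w`-end of `σ^[i + 1] a`.
  let L : ℕ → List A := fun n => (List.range n).flatMap fun i => [σ^[i] a, α (σ^[i] a)]
  have hLsucc : ∀ n, L (n + 1) = L n ++ [σ^[n] a, α (σ^[n] a)] := by
    intro n
    simp [L, List.range_succ]
  have hmem : ∀ b, b ∈ L k ↔ ∃ n, b = σ^[n] a ∨ b = α (σ^[n] a) := by
    intro b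
    simp only [L, List.mem_flatMap, List.mem_range, List.mem_cons, List.not_mem_nil, or_false]
    constructor
    · rintro ⟨n, -, h⟩
      exact ⟨n, h⟩
    · rintro ⟨n, h⟩
      exact ⟨n % k, Nat.mod_lt _ hk0, by rwa [hmodk]⟩
  have hβσ : ∀ n, β (σ^[n] a) ∈ L k := by
    intro n
    rw [hmem]
    cases n with
    | zero =>
      obtain ⟨j, rfl⟩ := Nat.exists_eq_add_of_lt hk0
      refine ⟨j, Or.inr ?_⟩
      rw [zero_add, Function.iterate_succ_apply', hσa] at hka
      rw [Function.iterate_zero_apply, ← hka, (hβ _).1, hka]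
    | succ j =>
      exact ⟨j, Or.inr (by rw [Function.iterate_succ_apply', hσa, (hβ _).1])⟩
  have hwalk : ∀ n, ∃ γ : G.Walk (w (ε a)) (w (ε (σ^[n] a))),
      γ.edges = ((L n).map ε).map Subtype.val := by
    intro n
    induction n with
    | zero => exact ⟨SimpleGraph.Walk.nil, by simp [L]⟩
    | succ n ih =>
      obtain ⟨γ, hγ⟩ := ih
      have hadj : ∀ x : G.edgeSet, G.Adj (w x) (u x) := by
        intro x
        rw [← SimpleGraph.mem_edgeSet, Sym2.eq_swap, ← huw]
        exact x.2
      have hw : w (ε (α (σ^[n] a))) = w (ε (σ^[n + 1] a)) := by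
        rw [Function.iterate_succ_apply', hσa, (hβ _).2.1]
      have h1 : G.Adj (w (ε (σ^[n] a))) (u (ε (σ^[n] a))) := hadj _
      have h2 : G.Adj (u (ε (σ^[n] a))) (w (ε (σ^[n + 1] a))) := by
        rw [← hw, ← (hα (σ^[n] a)).2.1]
        exact (hadj _).symm
      refine ⟨γ.append (.cons h1 (.cons h2 .nil)), ?_⟩
      rw [SimpleGraph.Walk.edges_append, hγ, hLsucc, List.map_append, List.map_append]
      congr 1
      simp only [SimpleGraph.Walk.edges_cons, SimpleGraph.Walk.edges_nil, List.map_cons,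
        List.map_nil, huw]
      rw [← hw, (hα (σ^[n] a)).2.1, Sym2.eq_swap]
  have hlast : ∀ n, ∀ y ∈ (L n).getLast?, β y = σ^[n] a := by
    intro n y hy
    cases n with
    | zero => simp [L] at hy
    | succ n =>
      rw [hLsucc] at hy
      simp at hy
      rw [← hy, Function.iterate_succ_apply', hσa]
  have hchain : ∀ n, ((L n).map ε).IsChain (· ≠ ·) := by
    intro n
    induction n with
    | zero => simp [L]
    | succ n ih =>
      rw [hLsucc, List.map_append, List.isChain_append]
      refine ⟨ih, by simpa using (hα _).2.2.symm, ?_⟩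
      intro x hx y hy
      rw [List.getLast?_map, Option.mem_map] at hx
      obtain ⟨z, hz, rfl⟩ := hx
      simp at hy
      rw [← hy, ← hlast n z hz]
      exact (hβ z).2.2.symm
  have hnodup : (L k).Nodup := by
    have hne : ∀ m n, α (σ^[m] a) ≠ σ^[n] a := by
      intro m n h
      -- Since `σ` has period `k` at `a`, the summand `(k - 1) * m` plays the role of `-m`.
      apply hdisj (n + (k - 1) * m) (σ^[m] a)
      rw [h, ← Function.iterate_add_apply, ← hmodk, ← hmodk (n + _ + m)]
      refine congrArg (fun i => σ^[i] a) ?_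
      have : n + (k - 1) * m + m = n + k * m := by
        obtain ⟨j, rfl⟩ := Nat.exists_eq_add_of_lt hk0
        simp; ring
      rw [this, Nat.add_mul_mod_self_left]
    rw [List.nodup_flatMap]
    refine ⟨fun n _ => ?_, ?_⟩
    · simpa using fun h => hdisj 0 _ h.symm
    · refine List.nodup_range.pairwise_of_forall_ne ?_
      intro m hm n hn hmn
      rw [List.mem_range] at hm hn
      have h1 : σ^[m] a ≠ σ^[n] a := fun h => hmn (hinjk m n hm hn h)
      intro x hx hy
      simp only [List.mem_cons, List.not_mem_nil, or_false] at hx hy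
      rcases hx with rfl | rfl <;> rcases hy with h | h
      · exact h1 h
      · exact hne _ _ h.symm
      · exact hne _ _ h
      · exact h1 (hαinj h)
  refine ⟨L k, hnodup, (hmem a).mpr ⟨0, Or.inl rfl⟩, ?_, ?_, ?_, hchain k, ?_⟩
  · intro b hb
    obtain ⟨n, rfl | rfl⟩ := (hmem b).mp hb
    · exact ⟨(hmem _).mpr ⟨n, Or.inr rfl⟩, hβσ n⟩
    · refine ⟨(hmem _).mpr ⟨n, Or.inl (hα _).1⟩, (hmem _).mpr ⟨n + 1, Or.inl ?_⟩⟩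
      rw [Function.iterate_succ_apply', hσa]
  · intro S ha hS b hb
    have hσS : ∀ n, σ^[n] a ∈ S := by
      intro n
      induction n with
      | zero => exact ha
      | succ n ih =>
        rw [Function.iterate_succ_apply', hσa]
        exact (hS _ (hS _ ih).1).2
    obtain ⟨n, rfl | rfl⟩ := (hmem b).mp hb
    · exact hσS n
    · exact (hS _ (hσS n)).1
  · obtain ⟨γ, hγ⟩ := hwalk k
    exact ⟨_, γ.copy rfl (by rw [hka]), by rw [SimpleGraph.Walk.edges_copy, hγ]⟩
  -- The last copy is the `β`-partner of `σ^[k] a = a`, the first one, so the two lie on different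
  -- edges.
  · have hhead : (L k).head? = some a := by
      obtain ⟨j, rfl⟩ := Nat.exists_eq_add_of_lt hk0
      simp [L, List.range_succ_eq_map]
    intro h
    rw [List.head?_map, hhead, List.getLast?_map, Option.map_some] at h
    obtain ⟨y, hy, hya⟩ := Option.map_eq_some_iff.mp h.symm
    have := hlast k y hy
    rw [hka] at this
    rw [← this] at hya
    exact (hβ y).2.2 hya.symm

/-- If the edge ends at every vertex are paired, then following the pairing decomposes the edges
into closed walks, hence into prime cycles. -/
theorem exists_multiset_primeCycles_of_involutions {V A : Type*} {G : SimpleGraph V} [Fintype A]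
    (u w : G.edgeSet → V) (huw : ∀ x : G.edgeSet, (x : Sym2 V) = s(u x, w x)) (ε : A → G.edgeSet)
    (α β : A → A) (hα : ∀ a, α (α a) = a ∧ u (ε (α a)) = u (ε a) ∧ ε (α a) ≠ ε a)
    (hβ : ∀ a, β (β a) = a ∧ w (ε (β a)) = w (ε a) ∧ ε (β a) ≠ ε a) (S : Finset A)
    (hS : ∀ a ∈ S, α a ∈ S ∧ β a ∈ S) :
    ∃ m : Multiset (primeCycles G),
      S.val.map ε = (m.map fun c : primeCycles G => (c : Cycle G.edgeSet).toMultiset).sum := by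
  classical
  induction S using Finset.strongInduction with
  | H S ih =>
    rcases S.eq_empty_or_nonempty with rfl | ⟨a, ha⟩
    · exact ⟨0, by simp⟩
    obtain ⟨L, hnodup, haL, hLcl, hLS, hcl, hb, ht⟩ :=
      exists_isClosedPath_of_involutions u w huw ε α β hα hβ a
    have hsub : L.toFinset ⊆ S := fun b hb => hLS S ha hS b (by simpa using hb)
    -- What remains after removing an orbit is still closed under both involutions.
    obtain ⟨m, hm⟩ := ih (S \ L.toFinset)
      (Finset.sdiff_ssubset hsub ⟨a, by simpa using haL⟩) (by
        intro b hb
        simp only [Finset.mem_sdiff, List.mem_toFinset] at hb ⊢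
        refine ⟨⟨(hS b hb.1).1, fun h => hb.2 ?_⟩, ⟨(hS b hb.1).2, fun h => hb.2 ?_⟩⟩
        · rw [← (hα b).1]; exact (hLcl _ h).1
        · rw [← (hβ b).1]; exact (hLcl _ h).2)
    obtain ⟨c, k, hck⟩ := exists_primeCycle_nsmul _ hcl hb ht
    refine ⟨k • {c} + m, ?_⟩
    have hval : S.val = (L : Multiset A) + (S \ L.toFinset).val := by
      calc S.val = (L.toFinset ∪ (S \ L.toFinset)).val := by
            rw [Finset.union_sdiff_of_subset hsub]
        _ = _ := by
          rw [← Finset.disjUnion_eq_union _ _ Finset.disjoint_sdiff, Finset.disjUnion_val,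
            List.toFinset_val, hnodup.dedup]
    rw [hval, Multiset.map_add, hm, Multiset.map_coe, hck, Multiset.map_add, Multiset.sum_add,
      Multiset.map_nsmul, Multiset.sum_nsmul, Multiset.map_singleton, Multiset.sum_singleton]

/-! ### The cycle code as the space of even edge sets -/

/-- An endpoint of a longest path is a leaf: a further neighbour would either lengthen the path or
close a cycle. -/
theorem exists_unique_adj_of_isAcyclic {V : Type*} [Finite V] {G : SimpleGraph V}
    (hG : G.IsAcyclic) {a b : V} (hab : G.Adj a b) : ∃ v y, G.Adj v y ∧ ∀ z, G.Adj v z → z = y := by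
  have : Nonempty V := ⟨a⟩
  obtain ⟨u, v, p, hp, hmax⟩ := SimpleGraph.Walk.exists_isPath_forall_isPath_length_le_length G
  have hnil : ¬ p.Nil := by
    intro h
    have h1 := hmax a b (.cons hab .nil) (by simp [hab.ne])
    rw [SimpleGraph.Walk.length_eq_zero_iff.mpr h] at h1
    simp at h1
  refine ⟨u, _, p.adj_snd hnil, fun w hadj ↦ ?_⟩
  apply hG.eq_snd_of_adj_start hp hadj
  have : ¬(p.cons hadj.symm).IsPath := by
    intro h
    have := hmax _ _ _ h
    rw [SimpleGraph.Walk.length_cons] at this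
    omega
  grind [hp.cons]

-- A trail repeats no edge, so the sum counts, modulo 2, the passages of a closed walk along edges
-- at `v`.
open Classical in
theorem sum_charVector_eq_zero {V : Type*} {G : SimpleGraph V} [Fintype G.edgeSet] {u : V}
    (γ : G.Walk u u) (hγ : γ.IsTrail) (v : V) :
    ∑ e : G.edgeSet with v ∈ e.1, charVector γ e = 0 := by
  have h1 := (even_countP_edges_iff γ v).mpr (Or.inl rfl)
  have h2 : (γ.edges.countP fun e => v ∈ e) =
      Finset.card {e : G.edgeSet | v ∈ (e : Sym2 V) ∧ (e : Sym2 V) ∈ γ.edges} := by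
    rw [List.countP_eq_length_filter, ← List.toFinset_card_of_nodup (hγ.edges_nodup.filter _),
      ← Finset.card_map (Function.Embedding.subtype _)]
    congr 1
    ext e
    simp only [List.mem_toFinset, List.mem_filter, decide_eq_true_eq, Finset.mem_map,
      Finset.mem_filter, Finset.mem_univ, true_and, Function.Embedding.subtype_apply,
      Subtype.exists, exists_and_right, exists_eq_right]
    exact ⟨fun ⟨h, hv⟩ => ⟨⟨γ.edges_subset_edgeSet h, hv⟩, h⟩, fun ⟨⟨_, hv⟩, h⟩ => ⟨h, hv⟩⟩
  rw [h2] at h1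
  simp only [charVector]
  rw [Finset.sum_ite, Finset.sum_const_zero, add_zero, Finset.sum_const, Finset.filter_filter,
    nsmul_one, ZMod.natCast_eq_zero_iff_even]
  convert h1

open Classical in
/-- A binary edge vector with even degree at each vertex is a sum of simple cycles. -/
theorem mem_cycleCode_of_sum_eq_zero {V : Type*} [Finite V] {G : SimpleGraph V} [Fintype G.edgeSet]
    (c : G.edgeSet → ZMod 2) (hc : ∀ v, ∑ e : G.edgeSet with v ∈ e.1, c e = 0) :
    c ∈ cycleCode G := by
  induction hn : Finset.card {e | c e ≠ 0} using Nat.strong_induction_on generalizing c with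
  | _ n ih =>
    by_cases h0 : c = 0
    · rw [h0]; exact Submodule.zero_mem _
    let G' : SimpleGraph V := SimpleGraph.fromEdgeSet {e | ∃ h : e ∈ G.edgeSet, c ⟨e, h⟩ ≠ 0}
    have hadj : ∀ a b, G'.Adj a b ↔ ∃ h : G.Adj a b, c ⟨s(a, b), h⟩ ≠ 0 := by
      intro a b
      rw [SimpleGraph.fromEdgeSet_adj]
      exact ⟨fun h => h.1, fun h => ⟨h, h.1.ne⟩⟩
    have hle : G' ≤ G := fun a b h => ((hadj a b).mp h).1
    -- A leaf of the support graph would reduce its vertex sum to a single nonzero term.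
    have hcyc : ¬ G'.IsAcyclic := by
      intro hac
      obtain ⟨e, he⟩ : ∃ e, c e ≠ 0 := by
        by_contra! h
        exact h0 (funext h)
      obtain ⟨e, heG⟩ := e
      induction e with
      | _ a b =>
        obtain ⟨v, y, hvy, huniq⟩ := exists_unique_adj_of_isAcyclic hac ((hadj a b).mpr ⟨heG, he⟩)
        obtain ⟨hG, hne⟩ := (hadj v y).mp hvy
        apply hne
        rw [← hc v, Finset.sum_eq_single_of_mem (⟨s(v, y), hG⟩ : G.edgeSet)
          (Finset.mem_filter.mpr ⟨Finset.mem_univ _, Sym2.mem_mk_left v y⟩)]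
        rintro ⟨x, hx⟩ hvx hxne
        rw [Finset.mem_filter] at hvx
        obtain ⟨z, rfl⟩ := hvx.2
        by_contra hcx
        exact hxne (Subtype.ext (show s(v, z) = s(v, y) by
          rw [huniq z ((hadj v z).mpr ⟨hx, hcx⟩)]))
    rw [SimpleGraph.IsAcyclic] at hcyc
    push Not at hcyc
    obtain ⟨v, γ, hγ⟩ := hcyc
    let δ := γ.mapLe hle
    have hδ : δ.IsCycle := hγ.mapLe hle
    have hedges : δ.edges = γ.edges := SimpleGraph.Walk.edges_mapLe_eq_edges hle γ
    have hsupp : ∀ e, charVector δ e ≠ 0 → c e = 1 := by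
      intro e he
      have hmem : (e : Sym2 V) ∈ γ.edges := by
        rw [← hedges]
        by_contra h
        exact he (by simp [charVector, h])
      have := γ.edges_subset_edgeSet hmem
      rw [SimpleGraph.edgeSet_fromEdgeSet] at this
      obtain ⟨⟨_, h1⟩, -⟩ := this
      exact Fin.eq_one_of_ne_zero _ h1
    -- The cycle lies inside the support of `c`, so subtracting it removes its edges from the
    -- support and adds none.
    have hlt : Finset.card {e | (c - charVector δ) e ≠ 0} < n := by
      rw [← hn]
      apply Finset.card_lt_card
      rw [Finset.ssubset_iff_of_subset]
      · have hne : γ.edges ≠ [] := by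
          intro h
          have := hγ.three_le_length
          rw [← SimpleGraph.Walk.length_edges, h] at this
          simp at this
        obtain ⟨x, hx⟩ := List.exists_mem_of_ne_nil _ hne
        have hxG : x ∈ G.edgeSet := SimpleGraph.edgeSet_mono hle (γ.edges_subset_edgeSet hx)
        have h1 : charVector δ ⟨x, hxG⟩ = 1 := by simp [charVector, hedges, hx]
        have h2 := hsupp ⟨x, hxG⟩ (by rw [h1]; exact one_ne_zero)
        exact ⟨⟨x, hxG⟩, by simp [h2], by simp [h1, h2]⟩
      · intro e he
        simp only [Finset.mem_filter, Finset.mem_univ, true_and, Pi.sub_apply] at he ⊢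
        intro hce
        by_cases h : charVector δ e = 0
        · exact he (by rw [h, hce, sub_zero])
        · have := hsupp e h
          rw [hce] at this
          exact zero_ne_one this
    have h1 := ih _ hlt (c - charVector δ) (fun v => by
      simp only [Pi.sub_apply, Finset.sum_sub_distrib, hc v,
        sum_charVector_eq_zero δ hδ.isCircuit.isTrail v, sub_zero]) rfl
    have h2 : charVector δ ∈ cycleCode G := Submodule.subset_span ⟨v, δ, hδ, rfl⟩
    simpa using Submodule.add_mem _ h1 h2

/-! ### Pseudo-codewords -/

/-- The integer vectors of the fundamental cone of `H` whose check sums are even. -/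
def IsEvenConeVector {F X : Type*} [Fintype X] (H : Matrix F X (ZMod 2)) (p : X → ℕ) : Prop :=
  ∀ j, Even (∑ i with H j i = 1, p i) ∧ ∀ i, H j i = 1 → 2 * p i ≤ ∑ i' with H j i' = 1, p i'

theorem card_filter_sigma_fin {X : Type*} [Fintype X] (p : X → ℕ) (P : X → Prop)
    [DecidablePred P] :
    Finset.card {a : Σ i, Fin (p i) | P a.1} = ∑ i with P i, p i := by
  classical
  have : ({a : Σ i, Fin (p i) | P a.1} : Finset _) =
      (Finset.univ.filter P).sigma fun _ => Finset.univ := by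
    ext a
    simp
  rw [this, Finset.card_sigma]
  simp

theorem sum_filter_and_eq {X : Type*} [Fintype X] [DecidableEq X] (P : X → Prop) [DecidablePred P]
    (x : X) (p : X → ℕ) : ∑ y with P y ∧ y = x, p y = if P x then p x else 0 := by
  rw [← Finset.filter_filter, Finset.sum_filter]
  simp

theorem ne_zero_iff_eq_one (x : ZMod 2) : x ≠ 0 ↔ x = 1 :=
  ⟨Fin.eq_one_of_ne_zero x, fun h => by rw [h]; exact one_ne_zero⟩

theorem mem_code_iff {F X : Type*} [Fintype X] (H : Matrix F X (ZMod 2)) (c : X → ZMod 2) :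
    c ∈ code H ↔ ∀ j, ∑ i with H j i = 1, c i = 0 := by
  rw [code, LinearMap.mem_ker, funext_iff]
  refine forall_congr' fun j => ?_
  rw [Matrix.mulVecLin_apply, Matrix.mulVec, dotProduct, Finset.sum_filter, Pi.zero_apply]
  have : ∀ i, H j i * c i = if H j i = 1 then c i else 0 := by
    intro i
    split_ifs with h
    · rw [h, one_mul]
    · rw [← ne_zero_iff_eq_one, not_not] at h
      rw [h, zero_mul]
  simp only [this]

theorem IsUnscaledPseudocodeword.isEvenConeVector {F X : Type*} [Fintype X]
    {H : Matrix F X (ZMod 2)} {p : X → ℕ} (hp : IsUnscaledPseudocodeword H p) :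
    IsEvenConeVector H p := by
  classical
  obtain ⟨M, -, H', hcov, a, ha, hpa⟩ := hp
  rw [mem_code_iff] at ha
  intro j
  have hH : ∀ k i l, H' (j, k) (i, l) = 1 → H j i = 1 := fun k i l h =>
    hcov.map_adj (v := Sum.inr (j, k)) (w := Sum.inl (i, l)) h
  have hl : ∀ k i, H j i = 1 → ∃ l, ∀ l', H' (j, k) (i, l') = 1 ↔ l' = l := by
    intro k i hi
    have hb := hcov.bijOn (Sum.inr (j, k))
    obtain ⟨x, hx, hxi⟩ := hb.surjOn (show Sum.inl i ∈ _ from hi)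
    obtain ⟨⟨i', l⟩⟩ | x := x
    · obtain rfl : i' = i := by simpa using hxi
      refine ⟨l, fun l' => ⟨fun h => ?_, fun h => h ▸ hx⟩⟩
      have := hb.injOn (show Sum.inl (i', l') ∈ _ from h) hx rfl
      simpa using this
    · simp at hxi
  have hk : ∀ i l, H j i = 1 → ∃ k, ∀ k', H' (j, k') (i, l) = 1 ↔ k' = k := by
    intro i l hi
    have hb := hcov.bijOn (Sum.inl (i, l))
    obtain ⟨x, hx, hxi⟩ := hb.surjOn (show Sum.inr j ∈ _ from hi)
    obtain x | ⟨⟨j', k⟩⟩ := x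
    · simp at hxi
    · obtain rfl : j' = j := by simpa using hxi
      refine ⟨k, fun k' => ⟨fun h => ?_, fun h => h ▸ hx⟩⟩
      have := hb.injOn (show Sum.inr (j', k') ∈ _ from h) hx rfl
      simpa using this
  -- For a neighbour `i` of `j`, `t k i` tells whether the unique node above `i` adjacent to `(j,
  -- k)` carries a nonzero value.
  let t : Fin M → X → ℕ := fun k i => ∑ l, if H' (j, k) (i, l) = 1 ∧ a (i, l) ≠ 0 then 1 else 0
  have ht1 : ∀ k i, H j i = 1 → t k i ≤ 1 := by
    intro k i hi
    obtain ⟨l, hl⟩ := hl k i hi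
    simp only [t, hl, ite_and, Finset.sum_ite_eq', Finset.mem_univ, if_true]
    split_ifs <;> simp
  have hsum : ∀ i, H j i = 1 → ∑ k, t k i = p i := by
    intro i hi
    rw [Finset.sum_comm, hpa, Set.ncard_eq_toFinset_card', Finset.card_eq_sum_ones]
    simp only [Set.toFinset_ofPred]
    rw [Finset.sum_filter]
    refine Finset.sum_congr rfl fun l _ => ?_
    obtain ⟨k, hk⟩ := hk i l hi
    simp only [hk, ite_and, Finset.sum_ite_eq', Finset.mem_univ, if_true]
  have heven : ∀ k, Even (∑ i with H j i = 1, t k i) := by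
    intro k
    rw [← ZMod.natCast_eq_zero_iff_even, ← ha (j, k), Finset.sum_filter, Finset.sum_filter,
      Fintype.sum_prod_type]
    push_cast
    refine Finset.sum_congr rfl fun i _ => ?_
    split_ifs with hi
    · simp only [t]
      push_cast
      refine Finset.sum_congr rfl fun l _ => ?_
      by_cases h1 : H' (j, k) (i, l) = 1
      · by_cases h2 : a (i, l) = 0
        · simp [h2]
        · simp [h1, (ne_zero_iff_eq_one _).mp h2]
      · simp [h1]
    · refine (Finset.sum_eq_zero fun l _ => if_neg fun h => hi (hH k i l h)).symm
  have htot : ∑ i with H j i = 1, p i = ∑ k, ∑ i with H j i = 1, t k i := by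
    rw [Finset.sum_comm]
    refine Finset.sum_congr rfl fun i hi => (hsum i ?_).symm
    simpa using hi
  refine ⟨htot ▸ Finset.even_sum _ fun k _ => heven k, fun i hi => ?_⟩
  rw [htot, ← hsum i hi, Finset.mul_sum]
  refine Finset.sum_le_sum fun k _ => ?_
  have h1 := ht1 k i hi
  have h2 : t k i ≤ ∑ i with H j i = 1, t k i :=
    Finset.single_le_sum (f := t k) (fun _ _ => Nat.zero_le _) (by simpa using hi)
  -- If `t k i = 1`, the sum at this lift is positive and even, hence at least 2.
  obtain ⟨m, hm⟩ := heven k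
  omega

theorem exists_perm_mem_iff {α : Type*} [Fintype α] [DecidableEq α] {S T : Finset α}
    (h : S.card = T.card) : ∃ π : Equiv.Perm α, ∀ x, π x ∈ T ↔ x ∈ S := by
  let e : {x // x ∈ S} ≃ {x // x ∈ T} := Finset.equivOfCardEq h
  refine ⟨e.extendSubtype, fun x => ⟨fun hx => ?_, fun hx => e.extendSubtype_mem x hx⟩⟩
  by_contra hxS
  exact e.extendSubtype_not_mem x hxS hx

/-- The codeword is `1` on the first `p i` sheets above each bit `i`. At a check `j`, copies of its
neighbours are paired bichromatically and pair `k` is assigned to `(j, k)`, so each lifted check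
sees no or two ones. Bichromaticity makes the assignment injective on each bit, so it extends to a
permutation of the sheets. -/
theorem IsEvenConeVector.isUnscaledPseudocodeword {F X : Type*} [Fintype X]
    {H : Matrix F X (ZMod 2)} {p : X → ℕ} (hp : IsEvenConeVector H p) :
    IsUnscaledPseudocodeword H p := by
  classical
  -- Large enough for every `p i` and for the number of pairs at every check; the `1` keeps `M`
  -- positive when `p = 0`.
  let M := 1 + ∑ i, p i
  have hpM : ∀ i, p i ≤ M := fun i =>
    (Finset.single_le_sum (f := p) (fun _ _ => Nat.zero_le _) (Finset.mem_univ i)).trans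
      (Nat.le_add_left _ _)
  obtain ⟨N, ⟨ι⟩⟩ := Finite.exists_equiv_fin X
  have hq : ∀ j, ∃ q : (Σ i, Fin (p i)) → ℕ, (∀ a, H j a.1 = 1 → q a < M) ∧
      (∀ a b, H j a.1 = 1 → H j b.1 = 1 → q a = q b → a.1 = b.1 → a = b) ∧
      ∀ k, Even (Finset.card {a | H j a.1 = 1 ∧ q a = k}) := by
    intro j
    obtain ⟨⟨h, hh⟩, hle⟩ := hp j
    have hcard := card_filter_sigma_fin p fun i => H j i = 1
    obtain ⟨q, hq1, hq2, hq3⟩ := exists_bichromatic_pairing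
      ({a : Σ i, Fin (p i) | H j a.1 = 1}) (fun a => ι a.1) h (by omega) (by
        intro e
        rw [Finset.filter_filter]
        simp only [← Equiv.eq_symm_apply]
        rw [card_filter_sigma_fin p fun i => H j i = 1 ∧ i = ι.symm e]
        rw [sum_filter_and_eq]
        split_ifs with he
        · have := hle _ he
          omega
        · exact Nat.zero_le _)
    have hhM : h ≤ M := by
      have : ∑ i with H j i = 1, p i ≤ ∑ i, p i :=
        Finset.sum_le_sum_of_subset (Finset.filter_subset _ _)
      omega
    refine ⟨q, fun a ha => (hq1 a (by simpa using ha)).trans_le hhM, ?_, ?_⟩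
    · intro a b ha hb hab h1
      exact hq2 a (by simpa using ha) b (by simpa using hb) hab (by rw [h1])
    · intro k
      rw [← Finset.filter_filter]
      rcases lt_or_ge k h with hk | hk
      · rw [hq3 k hk]
        exact even_two
      · rw [Finset.card_eq_zero.mpr]
        · exact Even.zero
        · rw [Finset.filter_eq_empty_iff]
          intro a ha
          exact (lt_of_lt_of_le (hq1 a ha) hk).ne
  choose q hqM hqinj hqeven using hq
  have hπ : ∀ j i, ∃ π : Equiv.Perm (Fin M), H j i = 1 →
      ∀ k, (π k : ℕ) < p i ↔ ∃ t, q j ⟨i, t⟩ = k := by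
    intro j i
    by_cases hi : H j i = 1
    · let φ : Fin (p i) → Fin M := fun t => ⟨q j ⟨i, t⟩, hqM j ⟨i, t⟩ hi⟩
      have hφ : Function.Injective φ := by
        intro t t' h
        have := hqinj j ⟨i, t⟩ ⟨i, t'⟩ hi hi (by simpa [φ] using h) rfl
        simpa using this
      obtain ⟨π, hπ⟩ := exists_perm_mem_iff (S := Finset.univ.image φ)
        (T := Finset.univ.image (Fin.castLE (hpM i))) (by
          rw [Finset.card_image_of_injective _ hφ,
            Finset.card_image_of_injective _ (Fin.castLE_injective _)])
      refine ⟨π, fun _ k => ?_⟩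
      have h1 := hπ k
      simp only [Finset.mem_image, Finset.mem_univ, true_and] at h1
      have h2 : (∃ x, Fin.castLE (hpM i) x = π k) ↔ (π k : ℕ) < p i :=
        ⟨fun ⟨x, hx⟩ => by rw [← hx]; exact x.2, fun h => ⟨⟨π k, h⟩, rfl⟩⟩
      rw [← h2, h1]
      exact exists_congr fun t => by rw [Fin.ext_iff]
    · exact ⟨1, fun h => absurd h hi⟩
  choose π hπ using hπ
  let H' : Matrix (F × Fin M) (X × Fin M) (ZMod 2) := fun jk il =>
    if H jk.1 il.1 = 1 ∧ π jk.1 il.1 jk.2 = il.2 then 1 else 0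
  have hH' : ∀ j k i l, H' (j, k) (i, l) = 1 ↔ H j i = 1 ∧ π j i k = l := by
    intro j k i l
    simp [H']
  refine ⟨M, Nat.le_add_right _ _, H', ⟨?_, ?_, ?_⟩, fun il => if (il.2 : ℕ) < p il.1 then 1 else 0,
    ?_, ?_⟩
  · have h0 : 0 < M := Nat.lt_of_lt_of_le Nat.zero_lt_one (Nat.le_add_right _ _)
    rintro (i | j)
    · exact ⟨Sum.inl (i, ⟨0, h0⟩), rfl⟩
    · exact ⟨Sum.inr (j, ⟨0, h0⟩), rfl⟩
  · rintro (⟨i, l⟩ | ⟨j, k⟩) (⟨i', l'⟩ | ⟨j', k'⟩) h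
    · exact h
    · exact ((hH' _ _ _ _).mp h).1
    · exact ((hH' _ _ _ _).mp h).1
    · exact h
  · rintro (⟨i, l⟩ | ⟨j, k⟩)
    · refine ⟨?_, ?_, ?_⟩
      · rintro (x | ⟨j, k⟩) h
        · exact h
        · exact ((hH' _ _ _ _).mp h).1
      · rintro (x | ⟨j, k⟩) h (x' | ⟨j', k'⟩) h' heq
        · exact absurd h id
        · exact absurd h id
        · exact absurd h' id
        · obtain rfl : j = j' := by simpa using heq
          have h1 := ((hH' _ _ _ _).mp h).2
          have h2 := ((hH' _ _ _ _).mp h').2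
          rw [(π j i).injective (h1.trans h2.symm)]
      · rintro (x | j) h
        · exact absurd h id
        · exact ⟨Sum.inr (j, (π j i).symm l), (hH' _ _ _ _).mpr ⟨h, by simp⟩, rfl⟩
    · refine ⟨?_, ?_, ?_⟩
      · rintro (⟨i, l⟩ | x) h
        · exact ((hH' _ _ _ _).mp h).1
        · exact h
      · rintro (⟨i, l⟩ | x) h (⟨i', l'⟩ | x') h' heq
        · obtain rfl : i = i' := by simpa using heq
          have h1 := ((hH' _ _ _ _).mp h).2
          have h2 := ((hH' _ _ _ _).mp h').2
          rw [← h1, ← h2]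
        · exact absurd h' id
        · exact absurd h id
        · exact absurd h id
      · rintro (i | x) h
        · exact ⟨Sum.inl (i, π j i k), (hH' _ _ _ _).mpr ⟨h, rfl⟩, rfl⟩
        · exact absurd h id
  · rw [mem_code_iff]
    rintro ⟨j, k⟩
    rw [Finset.sum_filter, Fintype.sum_prod_type]
    simp only [hH', ite_and]
    have h1 : ∀ i, (∑ l, if H j i = 1 then if π j i k = l then if (l : ℕ) < p i then (1 : ZMod 2)
        else 0 else 0 else 0) = if H j i = 1 ∧ ∃ t, q j ⟨i, t⟩ = k then 1 else 0 := by
      intro i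
      by_cases hi : H j i = 1
      · simp [hi, hπ j i hi k]
      · simp [hi]
    simp only [h1]
    rw [← Finset.sum_filter, Finset.sum_const, nsmul_one, ZMod.natCast_eq_zero_iff_even]
    convert hqeven j k using 1
    symm
    -- The bits seen as `1` from `(j, k)` correspond to the copies in class `k`, since a class
    -- contains each bit at most once.
    refine Finset.card_bij (fun a _ => a.1) ?_ ?_ ?_
    · rintro ⟨i, t⟩ ha
      simp only [Finset.mem_filter, Finset.mem_univ, true_and] at ha ⊢
      exact ⟨ha.1, t, ha.2⟩
    · rintro a ha b hb hab
      simp only [Finset.mem_filter, Finset.mem_univ, true_and] at ha hb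
      exact hqinj j a b ha.1 hb.1 (ha.2.trans hb.2.symm) hab
    · rintro i hi
      simp only [Finset.mem_filter, Finset.mem_univ, true_and] at hi
      obtain ⟨h, t, ht⟩ := hi
      exact ⟨⟨i, t⟩, by simpa using ⟨h, ht⟩, rfl⟩
  · intro i
    have h1 : {k : Fin M | (if (k : ℕ) < p i then (1 : ZMod 2) else 0) ≠ 0} =
        Set.range (Fin.castLE (hpM i)) := by
      ext k
      simp only [Set.mem_ofPred_eq, Set.mem_range]
      constructor
      · intro h
        have hk : (k : ℕ) < p i := by
          by_contra hk
          exact h (if_neg hk)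
        exact ⟨⟨k, hk⟩, rfl⟩
      · rintro ⟨x, rfl⟩
        simp
    simp only [h1]
    rw [← Set.image_univ, Set.ncard_image_of_injective _ (Fin.castLE_injective _),
      Set.ncard_univ, Nat.card_eq_fintype_card, Fintype.card_fin]

theorem isUnscaledPseudocodeword_iff {F X : Type*} [Fintype X]
    (H : Matrix F X (ZMod 2)) (p : X → ℕ) :
    IsUnscaledPseudocodeword H p ↔ IsEvenConeVector H p :=
  ⟨fun h => h.isEvenConeVector, fun h => h.isUnscaledPseudocodeword⟩

theorem isEvenConeVector_duplicateChecks {F X : Type*} [Fintype X] (H : Matrix F X (ZMod 2))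
    {copies : F → ℕ} (hcopies : ∀ j, 1 ≤ copies j) (p : X → ℕ) :
    IsEvenConeVector (duplicateChecks H copies) p ↔ IsEvenConeVector H p :=
  ⟨fun h j => h ⟨j, ⟨0, hcopies j⟩⟩, fun h j => h j.1⟩

/-! ### Edges of Tanner graphs -/

theorem exists_eq_of_mem_edgeSet_tannerGraph {F X : Type*} {H : Matrix F X (ZMod 2)}
    (x : (tannerGraph H).edgeSet) :
    ∃ ij : X × F, H ij.2 ij.1 = 1 ∧ (x : Sym2 (X ⊕ F)) = s(Sum.inl ij.1, Sum.inr ij.2) := by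
  obtain ⟨x, hx⟩ := x
  induction x with
  | _ a b =>
    rcases a with i | j <;> rcases b with i' | j'
    · exact absurd hx id
    · exact ⟨(i, j'), hx, rfl⟩
    · exact ⟨(i', j), hx, Sym2.eq_swap⟩
    · exact absurd hx id

/-- The bit node of an edge. -/
noncomputable def edgeBit {F X : Type*} {H : Matrix F X (ZMod 2)}
    (x : (tannerGraph H).edgeSet) : X :=
  (exists_eq_of_mem_edgeSet_tannerGraph x).choose.1

/-- The check node of an edge. -/
noncomputable def edgeCheck {F X : Type*} {H : Matrix F X (ZMod 2)}
    (x : (tannerGraph H).edgeSet) : F :=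
  (exists_eq_of_mem_edgeSet_tannerGraph x).choose.2

section

variable {F X : Type*} {H : Matrix F X (ZMod 2)}

theorem edge_eq (x : (tannerGraph H).edgeSet) :
    (x : Sym2 (X ⊕ F)) = s(Sum.inl (edgeBit x), Sum.inr (edgeCheck x)) :=
  (exists_eq_of_mem_edgeSet_tannerGraph x).choose_spec.2

theorem apply_edgeCheck_edgeBit (x : (tannerGraph H).edgeSet) : H (edgeCheck x) (edgeBit x) = 1 :=
  (exists_eq_of_mem_edgeSet_tannerGraph x).choose_spec.1

theorem inl_mem_edge_iff (x : (tannerGraph H).edgeSet) (i : X) :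
    Sum.inl i ∈ (x : Sym2 (X ⊕ F)) ↔ edgeBit x = i := by
  rw [edge_eq x]
  simp [eq_comm]

theorem inr_mem_edge_iff (x : (tannerGraph H).edgeSet) (j : F) :
    Sum.inr j ∈ (x : Sym2 (X ⊕ F)) ↔ edgeCheck x = j := by
  rw [edge_eq x]
  simp [eq_comm]

theorem exists_edge {i : X} {j : F} (h : H j i = 1) :
    ∃ x : (tannerGraph H).edgeSet, edgeBit x = i ∧ edgeCheck x = j := by
  let x : (tannerGraph H).edgeSet := ⟨s(Sum.inl i, Sum.inr j), h⟩
  exact ⟨x, (inl_mem_edge_iff x i).mp (Sym2.mem_mk_left _ _),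
    (inr_mem_edge_iff x j).mp (Sym2.mem_mk_right _ _)⟩

theorem edge_ext {x y : (tannerGraph H).edgeSet} (h1 : edgeBit x = edgeBit y)
    (h2 : edgeCheck x = edgeCheck y) : x = y :=
  Subtype.ext (by rw [edge_eq x, edge_eq y, h1, h2])

open Classical in
theorem sum_edgeCheck_eq [Fintype X] [Fintype (tannerGraph H).edgeSet] {M : Type*}
    [AddCommMonoid M] (f : X → M) (j : F) :
    ∑ x : (tannerGraph H).edgeSet with edgeCheck x = j, f (edgeBit x) =
      ∑ i with H j i = 1, f i := by
  refine Finset.sum_bij (fun x _ => edgeBit x) ?_ ?_ ?_ fun _ _ => rfl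
  · intro x hx
    rw [Finset.mem_filter] at hx ⊢
    exact ⟨Finset.mem_univ _, hx.2 ▸ apply_edgeCheck_edgeBit x⟩
  · intro x hx y hy hxy
    rw [Finset.mem_filter] at hx hy
    exact edge_ext hxy (hx.2.trans hy.2.symm)
  · intro i hi
    rw [Finset.mem_filter] at hi
    obtain ⟨x, hx1, hx2⟩ := exists_edge hi.2
    exact ⟨x, by simpa using hx2, hx1⟩

theorem natCard_edgeBit_fiber (i : X) :
    Nat.card {x : (tannerGraph H).edgeSet // edgeBit x = i} = bitDegree H i := by
  rw [bitDegree, ← Nat.card_coe_set_eq]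
  refine Nat.card_congr (Equiv.ofBijective (fun x => ⟨Sum.inr (edgeCheck x.1), ?_⟩) ⟨?_, ?_⟩)
  · exact (congrArg (H (edgeCheck x.1)) x.2).symm.trans (apply_edgeCheck_edgeBit x.1)
  · rintro ⟨x, hx⟩ ⟨y, hy⟩ hxy
    exact Subtype.ext (edge_ext (hx.trans hy.symm) (Sum.inr_injective (congrArg Subtype.val hxy)))
  · rintro ⟨i' | j, h⟩
    · exact absurd h id
    · obtain ⟨x, hx1, hx2⟩ := exists_edge (H := H) (i := i) (j := j) h
      exact ⟨⟨x, hx1⟩, by simp [hx2]⟩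

open Classical in
theorem card_edgeBit_eq [Fintype (tannerGraph H).edgeSet] (i : X) :
    Finset.card {x : (tannerGraph H).edgeSet | edgeBit x = i} = bitDegree H i := by
  rw [← natCard_edgeBit_fiber, Nat.card_eq_fintype_card, Fintype.card_subtype]

/-! ### Codes as punctured subcodes of cycle codes -/

theorem isPuncturedSubcode_cycleCode [Fintype X] [Finite F] (heven : BitEven H)
    (hpos : ∀ i, 0 < bitDegree H i) :
    IsPuncturedSubcode (code H) (cycleCode (tannerGraph H)) := by
  classical
  have : Fintype (tannerGraph H).edgeSet := Fintype.ofFinite _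
  have hex : ∀ i, ∃ x : (tannerGraph H).edgeSet, edgeBit x = i := by
    intro i
    have h := hpos i
    rw [← card_edgeBit_eq] at h
    obtain ⟨x, hx⟩ := Finset.card_pos.mp h
    exact ⟨x, by simpa using hx⟩
  choose f hf using hex
  -- One edge is kept per bit. This is a section of `edgeBit`, so puncturing undoes the repetition.
  let f' : X ↪ (tannerGraph H).edgeSet := ⟨f, Function.LeftInverse.injective hf⟩
  have hf' : edgeBit ∘ f' = id := funext hf
  refine ⟨(code H).map (LinearMap.funLeft (ZMod 2) (ZMod 2) edgeBit), ?_, f', ?_⟩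
  · rw [Submodule.map_le_iff_le_comap]
    intro c hc
    rw [mem_code_iff] at hc
    rw [Submodule.mem_comap]
    apply mem_cycleCode_of_sum_eq_zero
    simp only [LinearMap.funLeft_apply]
    rintro (i | j)
    · simp only [inl_mem_edge_iff]
      rw [Finset.sum_congr rfl fun x hx => congrArg c (Finset.mem_filter.mp hx).2,
        Finset.sum_const, card_edgeBit_eq, nsmul_eq_mul,
        (ZMod.natCast_eq_zero_iff_even).mpr (heven i), zero_mul]
    · simp only [inr_mem_edge_iff]
      rw [sum_edgeCheck_eq c j]
      convert hc j
  · rw [← Submodule.map_comp, ← LinearMap.funLeft_comp, hf']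
    exact Submodule.map_id (code H)

/-! ### Pseudo-codewords and the zeta function -/

theorem cycleExponent_coe_apply {E : Type*} [BEq E] [LawfulBEq E] (l : List E) (x : E) :
    cycleExponent (l : Cycle E) x = l.count x := by
  classical
  rw [cycleExponent]
  refine (Multiset.toFinsupp_apply _ _).trans ?_
  rw [Cycle.coe_toMultiset, Multiset.coe_count]
  unfold List.count
  exact List.countP_congr (by simp)

theorem sum_count_eq_countP {E : Type*} [Fintype E] [BEq E] [LawfulBEq E] (P : E → Prop)
    [DecidablePred P] (l : List E) : ∑ x with P x, l.count x = l.countP fun x => P x := by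
  classical
  induction l with
  | nil => simp
  | cons a l ih =>
    simp only [List.count_cons, List.countP_cons, Finset.sum_add_distrib, ih, beq_iff_eq,
      Finset.sum_ite_eq, Finset.mem_filter, Finset.mem_univ, true_and, decide_eq_true_eq]

/-- The parity and the half-sum bound at a check hold for each prime cycle and survive addition of
exponents. As `d` is constant on the edges at each bit, they become conditions on `p`. -/
theorem isEvenConeVector_of_coeff_ne_zero [Fintype X] [Finite F] {p : X → ℕ}
    {d : (tannerGraph H).edgeSet →₀ ℕ} (hd : ∀ x, d x = p (edgeBit x))
    (h : MvPowerSeries.coeff d (edgeZeta (tannerGraph H)) ≠ 0) : IsEvenConeVector H p := by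
  classical
  have : Fintype (tannerGraph H).edgeSet := Fintype.ofFinite _
  rw [coeff_edgeZeta_ne_zero_iff] at h
  obtain ⟨m, hm⟩ := h
  have key : ∀ j, Even (∑ x : (tannerGraph H).edgeSet with edgeCheck x = j, d x) ∧
      ∀ x, edgeCheck x = j → 2 * d x ≤ ∑ x with edgeCheck x = j, d x := by
    rw [hm]
    clear hm hd
    intro j
    induction m using Multiset.induction_on with
    | empty => simp
    | cons c m ih =>
      obtain ⟨ih1, ih2⟩ := ih
      rw [Multiset.map_cons, Multiset.sum_cons]
      simp only [Finsupp.add_apply, Finset.sum_add_distrib]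
      obtain ⟨c, l, rfl, hcl, hb, ht, -⟩ := c
      simp only [cycleExponent_coe_apply, sum_count_eq_countP]
      have h1 := even_countP_of_isClosedPath hcl (Sum.inr j)
      simp only [inr_mem_edge_iff] at h1
      refine ⟨h1.add ih1, fun x hx => ?_⟩
      have h2 := two_mul_count_le_countP hcl hb ht (Sum.inr j) x ((inr_mem_edge_iff x j).mpr hx)
      simp only [inr_mem_edge_iff] at h2
      rw [mul_add]
      exact add_le_add h2 (ih2 x hx)
  intro j
  obtain ⟨h1, h2⟩ := key j
  simp only [hd] at h1 h2
  rw [sum_edgeCheck_eq p j] at h1 h2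
  refine ⟨by convert h1, fun i hi => ?_⟩
  obtain ⟨x, hx1, hx2⟩ := exists_edge hi
  have := h2 x hx2
  rw [hx1] at this
  convert this

/-- Each edge `x` is replaced by `d x` copies coloured by `x`; matchings at the bits and at the
checks then decompose all the copies into prime cycles. -/
theorem IsEvenConeVector.coeff_ne_zero [Fintype X] [Finite F] (heven : BitEven H) {p : X → ℕ}
    {d : (tannerGraph H).edgeSet →₀ ℕ} (hd : ∀ x, d x = p (edgeBit x))
    (h : IsEvenConeVector H p) : MvPowerSeries.coeff d (edgeZeta (tannerGraph H)) ≠ 0 := by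
  classical
  have : Fintype (tannerGraph H).edgeSet := Fintype.ofFinite _
  have hbit : ∀ i, ∑ x : (tannerGraph H).edgeSet with edgeBit x = i, d x =
      bitDegree H i * p i := by
    intro i
    rw [← card_edgeBit_eq, ← smul_eq_mul, ← Finset.sum_const]
    refine Finset.sum_congr rfl fun x hx => ?_
    rw [hd, (Finset.mem_filter.mp hx).2]
  have hcheck : ∀ j, ∑ x : (tannerGraph H).edgeSet with edgeCheck x = j, d x =
      ∑ i with H j i = 1, p i := by
    intro j
    simp only [hd]
    rw [sum_edgeCheck_eq p j]
  obtain ⟨α, hα⟩ := exists_bichromatic_involution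
    (fun a : Σ x, Fin (d x) => edgeBit a.1) (fun a => a.1)
    (by
      intro i
      rw [card_filter_sigma_fin d fun x => edgeBit x = i, hbit]
      exact (heven i).mul_right _)
    (by
      intro i x
      rw [card_filter_sigma_fin d fun x => edgeBit x = i, hbit,
        card_filter_sigma_fin d fun y => edgeBit y = i ∧ y = x, sum_filter_and_eq]
      split_ifs with hx
      · rw [hd, hx]
        have h1 : 0 < bitDegree H i := by
          rw [← card_edgeBit_eq]
          exact Finset.card_pos.mpr ⟨x, by simpa using hx⟩
        -- A bit incident to an edge has positive even degree, hence at least 2, so one edge carries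
        -- at most half of the copies there.
        obtain ⟨k, hk⟩ := heven i
        exact Nat.mul_le_mul_right _ (by omega)
      · exact Nat.zero_le _)
  obtain ⟨β, hβ⟩ := exists_bichromatic_involution
    (fun a : Σ x, Fin (d x) => edgeCheck a.1) (fun a => a.1)
    (by
      intro j
      rw [card_filter_sigma_fin d fun x => edgeCheck x = j, hcheck]
      exact (h j).1)
    (by
      intro j x
      rw [card_filter_sigma_fin d fun x => edgeCheck x = j, hcheck,
        card_filter_sigma_fin d fun y => edgeCheck y = j ∧ y = x, sum_filter_and_eq]
      split_ifs with hx
      · rw [hd]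
        exact (h j).2 _ (hx ▸ apply_edgeCheck_edgeBit x)
      · exact Nat.zero_le _)
  obtain ⟨m, hm⟩ := exists_multiset_primeCycles_of_involutions
    (fun x : (tannerGraph H).edgeSet => Sum.inl (edgeBit x)) (fun x => Sum.inr (edgeCheck x))
    edge_eq (fun a : Σ x, Fin (d x) => a.1) α β
    (fun a => ⟨(hα a).1, congrArg _ (hα a).2.1, (hα a).2.2⟩)
    (fun a => ⟨(hβ a).1, congrArg _ (hβ a).2.1, (hβ a).2.2⟩) Finset.univ (by simp)
  rw [coeff_edgeZeta_ne_zero_iff]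
  refine ⟨m, ?_⟩
  have h1 : d = Multiset.toFinsupp ((Finset.univ : Finset (Σ x, Fin (d x))).val.map Sigma.fst) := by
    ext x
    rw [Multiset.toFinsupp_apply, Multiset.count_map, ← Finset.filter_val, Finset.card_val]
    have h2 := card_filter_sigma_fin d fun y => x = y
    rw [h2, Finset.sum_filter]
    simp
  rw [h1]
  refine (congrArg _ hm).trans ?_
  rw [map_multiset_sum, Multiset.map_map]
  refine congrArg _ (Multiset.map_congr rfl fun c _ => ?_)
  rw [Function.comp_apply, cycleExponent]
  congr!

/-- The edges, labelled by their bit node and their position at it. -/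
theorem exists_edge_labelling [Finite X] [Finite F] (H : Matrix F X (ZMod 2)) :
    ∃ e : (Σ i : X, Fin (bitDegree H i)) ≃ (tannerGraph H).edgeSet,
      ∀ ij, edgeBit (e ij) = ij.1 := by
  refine ⟨(Equiv.sigmaCongrRight fun i =>
    (Finite.equivFinOfCardEq (natCard_edgeBit_fiber (H := H) i)).symm).trans
      (Equiv.sigmaFiberEquiv edgeBit), fun ij => ?_⟩
  exact ((Finite.equivFinOfCardEq (natCard_edgeBit_fiber (H := H) ij.1)).symm ij.2).2

end

/-! ### Duplicated checks and the main theorem -/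

theorem code_duplicateChecks {F X : Type*} [Fintype X] (H : Matrix F X (ZMod 2)) {copies : F → ℕ}
    (hcopies : ∀ j, 1 ≤ copies j) : code (duplicateChecks H copies) = code H := by
  ext c
  rw [mem_code_iff, mem_code_iff]
  exact ⟨fun h j => h ⟨j, ⟨0, hcopies j⟩⟩, fun h j => h j.1⟩

theorem bitDegree_pos_iff {F X : Type*} [Finite F] [Finite X] (H : Matrix F X (ZMod 2)) (i : X) :
    0 < bitDegree H i ↔ ∃ j, H j i = 1 := by
  rw [bitDegree, Set.ncard_pos (Set.toFinite _)]
  constructor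
  · rintro ⟨i' | j, h⟩
    · exact absurd h id
    · exact ⟨j, h⟩
  · rintro ⟨j, h⟩
    exact ⟨Sum.inr j, h⟩

end TannerCode

open TannerCode
theorem mainTheorem4 {r n : ℕ} (H : Matrix (Fin r) (Fin n) (ZMod 2))
    (copies : Fin r → ℕ) (hcopies : ∀ j, 1 ≤ copies j)
    (heven : BitEven (duplicateChecks H copies)) :
    ((∀ i, 0 < bitDegree H i) →
      IsPuncturedSubcode (code H) (cycleCode (tannerGraph (duplicateChecks H copies)))) ∧
    ∃ e : (Σ i : Fin n, Fin (bitDegree (duplicateChecks H copies) i)) ≃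
        (tannerGraph (duplicateChecks H copies)).edgeSet,
      (∀ ij, Sum.inl ij.1 ∈ (e ij : Sym2 (Fin n ⊕ Σ j, Fin (copies j)))) ∧
      ∀ p : Fin n → ℕ, IsUnscaledPseudocodeword H p ↔
        MvPowerSeries.coeff (∑ ij, Finsupp.single (e ij) (p ij.1))
          (edgeZeta (tannerGraph (duplicateChecks H copies))) ≠ 0 := by
  constructor
  · intro hpos
    rw [← code_duplicateChecks H hcopies]
    refine isPuncturedSubcode_cycleCode heven fun i => ?_
    obtain ⟨j, hj⟩ := (bitDegree_pos_iff H i).mp (hpos i)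
    exact (bitDegree_pos_iff _ i).mpr ⟨⟨j, ⟨0, hcopies j⟩⟩, hj⟩
  · obtain ⟨e, he⟩ := exists_edge_labelling (duplicateChecks H copies)
    refine ⟨e, fun ij => (inl_mem_edge_iff _ _).mpr (he ij), fun p => ?_⟩
    have hd : ∀ x, (∑ ij, Finsupp.single (e ij) (p ij.1)) x = p (edgeBit x) := by
      intro x
      rw [Finsupp.finsetSum_apply, Finset.sum_eq_single (e.symm x)]
      · rw [Equiv.apply_symm_apply, Finsupp.single_eq_same, ← he, Equiv.apply_symm_apply]
      · intro ij _ hne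
        exact Finsupp.single_eq_of_ne fun h => hne (by rw [h, Equiv.symm_apply_apply])
      · simp
    rw [isUnscaledPseudocodeword_iff, ← isEvenConeVector_duplicateChecks H hcopies]
    exact ⟨fun h => h.coeff_ne_zero heven hd, isEvenConeVector_of_coeff_ne_zero hd⟩
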